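/- Let $\Omega=\{\ominus,\oplus\}^{\mathbb Z}$ with the product $\sigma$-algebra. An island of pluses is a configuration $x\in\Omega$ with finitely many, but at least one, components equal to $\oplus$; an island of minuses is one with finitely many, but at least one, components equal to $\ominus$. Write $\Delta_\oplus$, $\Delta_\ominus$ for the sets of these and $\Delta=\Delta_\oplus\cup\Delta_\ominus$. An archipelago (of pluses, of minuses) is a probability measure on $\Omega$ concentrated on $\Delta$ (on $\Delta_\oplus$, on $\Delta_\ominus$); let $\mathcal A,\mathcal A_\oplus,\mathcal A_\ominus$ be the sets of these. For $\alpha,\beta\in[0,1]$ let $F$ be the operator on probability measures on $\Omega$ of the probabilistic cellular automaton in which all sites are updated simultaneously and independently given the present configuration $x$, the site $k$ becoming $\oplus$ with probability $\theta(\oplus\mid x_kx_{k+1})$ and $\ominus$ otherwise, where $$\theta(\oplus\mid\ominus\ominus)=0,\quad \theta(\oplus\mid\oplus\ominus)=\beta,\quad \theta(\oplus\mid\ominus\oplus)=\alpha,\quad \theta(\oplus\mid\oplus\oplus)=1 .$$ For $\mu\in\mathcal A$ let $(x^t)_{t\ge 0}$ be the Markov chain on $\Omega$ with initial law $\mu$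 and this transition rule (so that $x^t$ has law $\mu F^t$), and let $$\tau_\mu=\inf\{t\ge 0:\ x^t=\text{all minuses or } x^t=\text{all pluses}\},\qquad \inf\emptyset=\infty .$$ Lemma. Let $0<\alpha\le 1$ and $0\le\beta<1$. If $\mu\in\mathcal A\setminus(\mathcal A_\ominus\cup\mathcal A_\oplus)$, then $\mathbb E(\tau_\mu)=\infty$. In particular, there are no $t\ge 0$ and $\lambda\in[0,1]$ with $\mu F^t=\pi_\lambda:=(1-\lambda)\delta_\ominus+\lambda\delta_\oplus$, where $\delta_\ominus$, $\delta_\oplus$ are the point masses at all minuses and all pluses; that is, $\inf\{t\ge0:\ \mu F^t=\pi_\lambda\text{ for some }\lambda\in[0,1]\}=\infty$. -/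

import Mathlib

open MeasureTheory ProbabilityTheory
open scoped ENNReal unitInterval

namespace Archipelago

/-! ### Configurations and islands -/

/-- A configuration assigns to each site of `ℤ` a plus (`true`) or a minus (`false`). The type
carries the product `σ`-algebra, which is the one generated by the cylinders. -/
abbrev Config : Type := ℤ → Bool

/-- The configuration ``all minuses''. -/
def allMinus : Config := fun _ => false

/-- The configuration ``all pluses''. -/
def allPlus : Config := fun _ => true

/-- Two configurations are close if they differ at finitely many sites only. -/
def Close (x y : Config) : Prop := {i : ℤ | x i ≠ y i}.Finite

/-- Islands of pluses: configurations with finitely many, but at least one, plus. -/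
def islandsPlus : Set Config := {x | Close x allMinus ∧ x ≠ allMinus}

/-- Islands of minuses: configurations with finitely many, but at least one, minus. -/
def islandsMinus : Set Config := {x | Close x allPlus ∧ x ≠ allPlus}

/-- All islands. -/
def islands : Set Config := islandsMinus ∪ islandsPlus

/-! ### Archipelagos -/

/-- Archipelagos: probability measures concentrated on the (countable) set of islands. -/
def archipelagos : Set (Measure Config) := {μ | IsProbabilityMeasure μ ∧ μ islandsᶜ = 0}

/-- Archipelagos of pluses. -/
def archipelagosPlus : Set (Measure Config) := {μ | IsProbabilityMeasure μ ∧ μ islandsPlusᶜ = 0}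

/-- Archipelagos of minuses. -/
def archipelagosMinus : Set (Measure Config) := {μ | IsProbabilityMeasure μ ∧ μ islandsMinusᶜ = 0}

/-! ### The cellular automaton -/

/-- The probability `θ(+ | a₀ a₁)` that a site is a plus at the next time, when its own present
state is `a₀` and that of its right neighbour is `a₁`. -/
def plusProb (α β : I) : Bool → Bool → I
  | false, false => 0
  | true, false => β
  | false, true => α
  | true, true => 1

/-- The transition probabilities `θ(b | a₀ a₁)`. -/
def trans (α β : I) (b a₀ a₁ : Bool) : ℝ :=
  if b = true then (plusProb α β a₀ a₁ : ℝ) else 1 - (plusProb α β a₀ a₁ : ℝ)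

/-- The law on `{-, +}` with weights `θ(b | a₀ a₁)`. -/
noncomputable def siteLaw (α β : I) (a₀ a₁ : Bool) : Measure Bool :=
  ENNReal.ofReal (trans α β true a₀ a₁) • Measure.dirac true +
    ENNReal.ofReal (trans α β false a₀ a₁) • Measure.dirac false

theorem siteLaw_singleton (α β : I) (b a₀ a₁ : Bool) :
    siteLaw α β a₀ a₁ {b} = ENNReal.ofReal (trans α β b a₀ a₁) := by
  cases b <;> simp [siteLaw]

instance (α β : I) (a₀ a₁ : Bool) : IsProbabilityMeasure (siteLaw α β a₀ a₁) := by
  constructor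
  have h0 := (plusProb α β a₀ a₁).2.1
  have h1 : 0 ≤ 1 - (plusProb α β a₀ a₁ : ℝ) := sub_nonneg.2 (plusProb α β a₀ a₁).2.2
  simp [siteLaw, trans, ← ENNReal.ofReal_add h0 h1]

/-- The law of the configuration one step after `x`: the sites are updated independently, the
site `k` according to `θ(· | x_k x_{k+1})`. -/
noncomputable def stepLaw (α β : I) (x : Config) : Measure Config :=
  Measure.infinitePi fun k : ℤ => siteLaw α β (x k) (x (k + 1))

instance (α β : I) (x : Config) : IsProbabilityMeasure (stepLaw α β x) := by
  unfold stepLaw; infer_instance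

theorem stepLaw_pi (α β : I) (x : Config) (s : Finset ℤ) (t : ℤ → Set Bool) :
    stepLaw α β x (Set.pi s t) = ∏ k ∈ s, siteLaw α β (x k) (x (k + 1)) (t k) :=
  Measure.infinitePi_pi _ fun _ _ => MeasurableSet.of_discrete

theorem measurable_local (g : Bool → Bool → ℝ≥0∞) (k : ℤ) :
    Measurable fun x : Config => g (x k) (x (k + 1)) := by
  have h : Measurable (Function.uncurry g) := Measurable.of_discrete
  have e : Measurable fun x : Config => (x k, x (k + 1)) := by fun_prop
  exact h.comp e

theorem measurable_stepLaw (α β : I) : Measurable (stepLaw α β) := by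
  have key : ∀ A ∈ squareCylinders fun _ : ℤ => {S : Set Bool | MeasurableSet S},
      Measurable fun x => stepLaw α β x A := by
    rintro _ ⟨s, t, -, rfl⟩
    simp only [stepLaw_pi]
    exact Finset.measurable_fun_prod _ fun k _ => measurable_local (fun a b => siteLaw α β a b (t k)) k
  have hpi : IsPiSystem (squareCylinders fun _ : ℤ => {S : Set Bool | MeasurableSet S}) :=
    isPiSystem_squareCylinders (fun _ => MeasurableSpace.isPiSystem_measurableSet)
      (fun _ => MeasurableSet.univ (α := Bool))
  exact Measurable.measure_of_isPiSystem_of_isProbabilityMeasure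
    generateFrom_squareCylinders.symm hpi key

/-- The one step transition kernel of the cellular automaton. -/
noncomputable def stepKernel (α β : I) : Kernel Config Config :=
  ⟨stepLaw α β, measurable_stepLaw α β⟩

instance (α β : I) : IsMarkovKernel (stepKernel α β) :=
  ⟨fun x => inferInstanceAs (IsProbabilityMeasure (stepLaw α β x))⟩

/-- The operator `F`, acting on measures: `F α β μ` is the measure `μF`. -/
noncomputable def F (α β : I) (μ : Measure Config) : Measure Config := μ.bind (stepKernel α β)

/-- The values of `μF` on the thin cylinders. -/
theorem F_cylinder (α β : I) (μ : Measure Config) (s : Finset ℤ) (b : ℤ → Bool) :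
    F α β μ {y | ∀ k ∈ s, y k = b k} =
      ∫⁻ x, ∏ k ∈ s, ENNReal.ofReal (trans α β (b k) (x k) (x (k + 1))) ∂μ := by
  have h : {y : Config | ∀ k ∈ s, y k = b k} = Set.pi s fun k => {b k} := by
    ext y; simp [Set.mem_pi]
  rw [h, F, Measure.bind_apply (MeasurableSet.pi s.countable_toSet fun _ _ => .of_discrete)
    (Kernel.aemeasurable _)]
  refine lintegral_congr fun x => ?_
  change stepLaw α β x _ = _
  simp only [stepLaw_pi, siteLaw_singleton]

/-- The measures `π_l = (1 - l) δ_- + l δ_+`. -/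
noncomputable def mix (l : I) : Measure Config :=
  ENNReal.ofReal (1 - (l : ℝ)) • Measure.dirac allMinus +
    ENNReal.ofReal (l : ℝ) • Measure.dirac allPlus

/-! ### The random process and its absorption time -/

/-- The law of the trajectory `(x⁰, x¹, x², …)` of the Markov chain with initial law `μ` and
transition kernel `stepKernel α β`. -/
noncomputable def processLaw (α β : I) (μ : Measure Config) : Measure (ℕ → Config) :=
  Kernel.trajMeasure (X := fun _ => Config) μ fun n =>
    (stepKernel α β).comap (fun h => h ⟨n, Finset.mem_Iic.2 le_rfl⟩) (measurable_pi_apply _)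

theorem processLaw_map_zero (α β : I) (μ : Measure Config) :
    (processLaw α β μ).map (fun ω => ω 0) = μ := by
  have h0 : (fun ω : ℕ → Config => ω 0) =
      (MeasurableEquiv.piUnique fun _ : Finset.Iic 0 => Config) ∘ Preorder.frestrictLe 0 := rfl
  rw [h0, ← Measure.map_map (by fun_prop) (by fun_prop), processLaw, Kernel.trajMeasure,
    Measure.map_comp _ _ (by fun_prop), Kernel.traj_map_frestrictLe, Kernel.partialTraj_self,
    Measure.id_comp, Measure.map_map (by fun_prop) (by fun_prop)]
  exact Measure.map_id

/-- At time `t` the process has law `μF^t`. -/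
theorem processLaw_map (α β : I) (μ : Measure Config) [IsProbabilityMeasure μ] (t : ℕ) :
    (processLaw α β μ).map (fun ω => ω t) = (F α β)^[t] μ := by
  induction t with
  | zero => exact processLaw_map_zero α β μ
  | succ t ih =>
    rw [Function.iterate_succ_apply', ← ih]
    have h := Kernel.map_frestrictLe_trajMeasure_compProd_eq_map_trajMeasure
      (X := fun _ => Config) (μ₀ := μ) (κ := fun n => (stepKernel α β).comap
        (fun h => h ⟨n, Finset.mem_Iic.2 le_rfl⟩) (measurable_pi_apply _)) (a := t)
    have h2 := congrArg (fun ν => Measure.map Prod.snd ν) h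
    beta_reduce at h2
    rw [Measure.map_map (by fun_prop) (by fun_prop)] at h2
    change Measure.snd _ = Measure.map (fun ω => ω (t + 1)) (processLaw α β μ) at h2
    rw [Measure.snd_compProd] at h2
    rw [← h2, F]
    ext A hA
    rw [Measure.bind_apply hA (Kernel.aemeasurable _), Measure.bind_apply hA (Kernel.aemeasurable _),
      lintegral_map (Kernel.measurable_coe _ hA) (by fun_prop),
      lintegral_map (Kernel.measurable_coe _ hA) (by fun_prop)]
    rfl

/-- The random time `τ`: the first time at which the trajectory is in one of the configurations
``all minuses'' and ``all pluses''; it is `∞` if there is no such time. -/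
noncomputable def absorptionTime (ω : ℕ → Config) : ℝ≥0∞ :=
  ⨅ (t : ℕ) (_ : ω t = allMinus ∨ ω t = allPlus), (t : ℝ≥0∞)

/-- The expectation `E(τ_μ)` for the process started from `μ`. -/
noncomputable def meanTime (α β : I) (μ : Measure Config) : ℝ≥0∞ :=
  ∫⁻ ω, absorptionTime ω ∂(processLaw α β μ)

/-- The first time `t` at which the measure `μF^t` itself is one of the measures `π_l`; it is `∞`
if there is no such time. -/
noncomputable def measureTime (α β : I) (μ : Measure Config) : ℕ∞ :=
  ⨅ (t : ℕ) (_ : ∃ l : I, (F α β)^[t] μ = mix l), (t : ℕ∞)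

end Archipelago

open MeasureTheory ProbabilityTheory
open scoped ENNReal unitInterval

namespace Archipelago

/-! ### The number of sites of a given colour -/

/-! A measure as in the theorem charges both kinds of islands, so it suffices that single islands of
one kind have infinite mean absorption time. If `α + β ≥ 1` this kind is the islands of pluses, if
`α + β ≤ 1` the islands of minuses: the automaton then dominates a voter model in that colour, and
the number of sites of this colour is a submartingale, with mean at least `1` at all times. The
colour spreads by at most one site per step, so its count at time `t` is at most `w + t`, and it
vanishes on absorption. Hence the chain is unabsorbed at time `t` with probability at least `1 / (w
+ t)`, and the harmonic series diverges (`meanTime_dirac_eq_top`). If `μF^t` were some `π_λ`, then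
`τ ≤ t` almost surely, so the mean would be finite. -/

/-- The number of sites at which a configuration has the colour `c`. -/
noncomputable def colourCount (c : Bool) (x : Config) : ℝ≥0∞ :=
  ∑' k : ℤ, if x k = c then 1 else 0

theorem measurableSet_coord_eq (c : Bool) (k : ℤ) : MeasurableSet {x : Config | x k = c} :=
  measurableSet_eq_fun (measurable_pi_apply k) measurable_const

theorem measurable_colourCount (c : Bool) : Measurable (colourCount c) :=
  Measurable.tsum fun k =>
    Measurable.ite (measurableSet_coord_eq c k) measurable_const measurable_const

theorem stepLaw_coord (α β : I) (x : Config) (c : Bool) (k : ℤ) :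
    stepLaw α β x {y | y k = c} = ENNReal.ofReal (trans α β c (x k) (x (k + 1))) := by
  have h : {y : Config | y k = c} = Set.pi ({k} : Finset ℤ) fun _ => {c} := by
    ext y; simp
  rw [h, stepLaw_pi]
  simp [siteLaw_singleton]

/-- If the transition probabilities to the colour `c` dominate those of a voter model, then the
mean number of sites of colour `c` does not decrease in one step. -/
theorem colourCount_le_lintegral_stepLaw {α β : I} {c : Bool} {γ : I}
    (h : ∀ a b : Bool, (γ : ℝ) * (if b = c then 1 else 0) + (1 - γ) * (if a = c then 1 else 0) ≤
      trans α β c a b) (x : Config) :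
    colourCount c x ≤ ∫⁻ y, colourCount c y ∂stepLaw α β x := by
  have h0 : 0 ≤ (γ : ℝ) := γ.2.1
  have h1 : 0 ≤ 1 - (γ : ℝ) := sub_nonneg.2 γ.2.2
  -- Counting is translation invariant, so both parts of the convex combination sum to multiples of
  -- the same count.
  have hshift : ∑' k : ℤ, (if x (k + 1) = c then (1 : ℝ≥0∞) else 0) = colourCount c x :=
    (Equiv.addRight (1 : ℤ)).tsum_eq fun k => if x k = c then (1 : ℝ≥0∞) else 0
  calc colourCount c x
      = ENNReal.ofReal γ * colourCount c x + ENNReal.ofReal (1 - γ) * colourCount c x := by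
        rw [← add_mul, ← ENNReal.ofReal_add h0 h1]; simp
    _ = ∑' k : ℤ, (ENNReal.ofReal γ * (if x (k + 1) = c then 1 else 0) +
          ENNReal.ofReal (1 - γ) * (if x k = c then 1 else 0)) := by
        rw [ENNReal.tsum_add, ENNReal.tsum_mul_left, ENNReal.tsum_mul_left, hshift, colourCount]
    _ ≤ ∑' k : ℤ, stepLaw α β x {y | y k = c} := by
        refine ENNReal.tsum_le_tsum fun k => ?_
        rw [stepLaw_coord]
        refine le_trans (le_of_eq ?_) (ENNReal.ofReal_le_ofReal (h (x k) (x (k + 1))))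
        rw [ENNReal.ofReal_add (by positivity) (mul_nonneg h1 (by positivity)),
          ENNReal.ofReal_mul h0, ENNReal.ofReal_mul h1]
        congr 2 <;> split_ifs <;> simp
    _ = ∫⁻ y, colourCount c y ∂stepLaw α β x := by
        unfold colourCount
        rw [lintegral_tsum fun k => (Measurable.ite (measurableSet_coord_eq c k)
          measurable_const measurable_const).aemeasurable]
        refine tsum_congr fun k => ?_
        rw [← lintegral_indicator_one (measurableSet_coord_eq c k)]
        exact lintegral_congr fun y => by simp [Set.indicator_apply]

theorem colourCount_le_lintegral_iterate {α β : I} {c : Bool} {γ : I}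
    (h : ∀ a b : Bool, (γ : ℝ) * (if b = c then 1 else 0) + (1 - γ) * (if a = c then 1 else 0) ≤
      trans α β c a b) (x : Config) (t : ℕ) :
    colourCount c x ≤ ∫⁻ y, colourCount c y ∂((F α β)^[t] (Measure.dirac x)) := by
  induction t with
  | zero => simp [lintegral_dirac' _ (measurable_colourCount c)]
  | succ t ih =>
    rw [Function.iterate_succ_apply', F, Measure.lintegral_bind (Kernel.aemeasurable _)
      (measurable_colourCount c).aemeasurable]
    exact ih.trans (lintegral_mono fun y => colourCount_le_lintegral_stepLaw h y)

theorem one_le_colourCount {c : Bool} {x : Config} {k : ℤ} (h : x k = c) :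
    1 ≤ colourCount c x := by
  refine le_trans (le_of_eq ?_) (ENNReal.le_tsum k)
  simp [h]

theorem colourCount_const_not (c : Bool) : colourCount c (fun _ => !c) = 0 := by
  simp [colourCount]

theorem colourCount_le_card {c : Bool} {x : Config} {s : Finset ℤ} (h : ∀ k, x k = c → k ∈ s) :
    colourCount c x ≤ s.card := by
  rw [colourCount, tsum_eq_sum (s := s) fun k hk => if_neg fun e => hk (h k e)]
  refine (Finset.sum_le_sum fun k _ => (show _ ≤ (1 : ℝ≥0∞) by split_ifs <;> simp)).trans ?_
  simp

/-! ### Trajectories -/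

/-- A site whose own state and that of its right neighbour agree keeps its state. -/
def Admissible (x y : Config) : Prop := ∀ (c : Bool) (k : ℤ), x k = c → x (k + 1) = c → y k = c

/-- Equal neighbours are updated deterministically. This is all the pathwise information needed: it
makes absorption permanent and limits the growth of islands. -/
theorem ae_stepLaw_admissible (α β : I) (x : Config) : ∀ᵐ y ∂stepLaw α β x, Admissible x y := by
  refine ae_all_iff.2 fun c => ae_all_iff.2 fun k => ?_
  by_cases h : x k = c ∧ x (k + 1) = c
  · have h2 : stepLaw α β x {y | y k = !c} = 0 := by
      rw [stepLaw_coord, h.1, h.2]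
      cases c <;> simp [trans, plusProb]
    refine measure_mono_null (fun y hy => ?_) h2
    have hy' : ¬ y k = c := fun e => hy fun _ _ => e
    simpa [Bool.eq_not] using hy'
  · exact .of_forall fun y h1 h2 => (h ⟨h1, h2⟩).elim

theorem measurableSet_admissible : MeasurableSet {p : Config × Config | Admissible p.1 p.2} := by
  have hm : ∀ (c : Bool) (k : ℤ), MeasurableSet {p : Config × Config |
      p.1 k = c → p.1 (k + 1) = c → p.2 k = c} := fun c k => by
    have h1 := (measurable_fst : Measurable (Prod.fst : Config × Config → Config)) (measurableSet_coord_eq c k)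
    have h2 := (measurable_fst : Measurable (Prod.fst : Config × Config → Config))
      (measurableSet_coord_eq c (k + 1))
    have h3 := (measurable_snd : Measurable (Prod.snd : Config × Config → Config)) (measurableSet_coord_eq c k)
    exact h1.imp (h2.imp h3)
  simp only [Admissible, Set.ofPred_forall]
  exact .iInter fun c => .iInter fun k => by
    simpa only [Set.ofPred_forall] using hm c k

instance (α β : I) (μ : Measure Config) [IsProbabilityMeasure μ] :
    IsProbabilityMeasure (processLaw α β μ) := by
  unfold processLaw; infer_instance

/-- The joint law of two successive states. -/
theorem processLaw_map_pair (α β : I) (μ : Measure Config) [IsProbabilityMeasure μ] (t : ℕ) :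
    (processLaw α β μ).map (fun ω => (ω t, ω (t + 1))) =
      ((processLaw α β μ).map fun ω => ω t) ⊗ₘ stepKernel α β := by
  have h := Kernel.map_frestrictLe_trajMeasure_compProd_eq_map_trajMeasure
    (X := fun _ => Config) (μ₀ := μ) (κ := fun n => (stepKernel α β).comap
      (fun h => h ⟨n, Finset.mem_Iic.2 le_rfl⟩) (measurable_pi_apply _)) (a := t)
  -- The kernel sees the history only through its last state, so the rest of the history can be
  -- projected away.
  have hg : Measurable fun p : (Finset.Iic t → Config) × Config =>
      (p.1 ⟨t, Finset.mem_Iic.2 le_rfl⟩, p.2) := by fun_prop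
  have h2 := congrArg (fun ν => Measure.map (fun p : (Finset.Iic t → Config) × Config =>
      (p.1 ⟨t, Finset.mem_Iic.2 le_rfl⟩, p.2)) ν) h
  beta_reduce at h2
  rw [Measure.map_map hg (by fun_prop)] at h2
  change _ = Measure.map (fun ω => (ω t, ω (t + 1))) (processLaw α β μ) at h2
  rw [← h2]
  ext A hA
  rw [Measure.map_apply hg hA, Measure.compProd_apply (hg hA), Measure.compProd_apply hA,
    lintegral_map (Kernel.measurable_kernel_prodMk_left hA) (by fun_prop),
    lintegral_map (Kernel.measurable_kernel_prodMk_left (hg hA)) (by fun_prop)]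
  rfl

theorem ae_processLaw_admissible (α β : I) (μ : Measure Config) [IsProbabilityMeasure μ] :
    ∀ᵐ ω ∂processLaw α β μ, ∀ t, Admissible (ω t) (ω (t + 1)) := by
  refine ae_all_iff.2 fun t => ?_
  have hm : Measurable fun ω : ℕ → Config => (ω t, ω (t + 1)) := by fun_prop
  have h : ∀ᵐ p ∂(processLaw α β μ).map (fun ω => (ω t, ω (t + 1))), Admissible p.1 p.2 := by
    rw [processLaw_map_pair]
    exact Measure.ae_compProd_of_ae_ae measurableSet_admissible
      (.of_forall fun x => ae_stepLaw_admissible α β x)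
  exact ae_of_ae_map hm.aemeasurable h

theorem ae_processLaw_dirac_zero (α β : I) (x : Config) :
    ∀ᵐ ω ∂processLaw α β (Measure.dirac x), ω 0 = x := by
  have h : ∀ᵐ y ∂(processLaw α β (Measure.dirac x)).map (fun ω => ω 0), y = x := by
    rw [processLaw_map_zero, ae_dirac_eq]
    exact Filter.eventually_pure.2 rfl
  exact ae_of_ae_map (measurable_pi_apply 0).aemeasurable h

/-! ### Absorption -/

/-- The two absorbing configurations. -/
def absorbing : Set Config := {allMinus, allPlus}

theorem measurableSet_absorbing : MeasurableSet absorbing :=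
  (measurableSet_singleton _).insert _

theorem mem_absorbing_iff {x : Config} (c : Bool) :
    x ∈ absorbing ↔ x = (fun _ => c) ∨ x = fun _ => !c := by
  cases c
  · rfl
  · exact or_comm

theorem absorbing_of_admissible {x y : Config} (h : Admissible x y) (hx : x ∈ absorbing) :
    y ∈ absorbing := by
  rcases hx with rfl | rfl
  · exact Or.inl (funext fun k => h false k rfl rfl)
  · exact Or.inr (funext fun k => h true k rfl rfl)

/-- Absorption is permanent, so every unabsorbed time precedes every absorbed one. -/
theorem tsum_indicator_le_absorptionTime {ω : ℕ → Config}
    (h : ∀ t, Admissible (ω t) (ω (t + 1))) :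
    ∑' t, absorbingᶜ.indicator (1 : Config → ℝ≥0∞) (ω t) ≤ absorptionTime ω := by
  refine le_iInf₂ fun t ht => ?_
  have hs : ∀ s, t ≤ s → ω s ∈ absorbing := fun s hs => by
    induction s, hs using Nat.le_induction with
    | base => exact ht
    | succ s _ ih => exact absorbing_of_admissible (h s) ih
  rw [tsum_eq_sum (s := Finset.range t) fun s hs' =>
    Set.indicator_of_notMem (Set.notMem_compl_iff.2 (hs s (by simpa using hs'))) _]
  refine (Finset.sum_le_sum fun s _ => Set.indicator_le_self' (f := (1 : Config → ℝ≥0∞))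
    (fun _ _ => zero_le) (ω s)).trans ?_
  simp

theorem measurable_absorptionTime : Measurable absorptionTime := by
  classical
  refine Measurable.iInf fun t => ?_
  have hm : MeasurableSet {ω : ℕ → Config | ω t = allMinus ∨ ω t = allPlus} :=
    (measurable_pi_apply t : Measurable fun ω : ℕ → Config => ω t) measurableSet_absorbing
  simp only [iInf_eq_if]
  exact Measurable.ite hm measurable_const measurable_const

/-- The support grows by at most one site per step, to the left. -/
theorem mem_Icc_of_admissible {ω : ℕ → Config} (h : ∀ t, Admissible (ω t) (ω (t + 1)))
    {c : Bool} {a b : ℤ} (h0 : ∀ k, ω 0 k = c → k ∈ Finset.Icc a b) (t : ℕ) :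
    ∀ k, ω t k = c → k ∈ Finset.Icc (a - t) b := by
  induction t with
  | zero => simpa using h0
  | succ t ih =>
    intro k hk
    have hor : ω t k = c ∨ ω t (k + 1) = c := by
      by_contra! hne
      -- Two neighbours of the opposite colour would have forced `!c` at `k`.
      have := h t (!c) k (by simpa [Bool.eq_not] using hne.1) (by simpa [Bool.eq_not] using hne.2)
      simp [hk] at this
    rcases hor with h1 | h1 <;> have h2 := ih _ h1 <;> rw [Finset.mem_Icc] at h2 ⊢ <;>
      push_cast <;> constructor <;> omega

theorem colourCount_le_mul_indicator {x : Config} {c : Bool} {a b : ℤ} (t : ℕ)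
    (h : ∀ k, x k = c → k ∈ Finset.Icc (a - t) b) :
    colourCount c x ≤
      (((b + 1 - a).toNat + t : ℕ) : ℝ≥0∞) * absorbingᶜ.indicator (1 : Config → ℝ≥0∞) x := by
  by_cases hx : x ∈ absorbing
  · rcases (mem_absorbing_iff c).1 hx with rfl | rfl
    -- The constant configuration `c` is excluded, as its support is not bounded.
    · have := h (b + 1) rfl
      simp at this
    · simp [colourCount_const_not]
  · rw [Set.indicator_of_mem (show x ∈ absorbingᶜ from hx), Pi.one_apply, mul_one]
    refine (colourCount_le_card h).trans ?_
    rw [Int.card_Icc]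
    exact_mod_cast (by omega : (b + 1 - (a - t)).toNat ≤ (b + 1 - a).toNat + t)

theorem tsum_inv_natCast_add (w : ℕ) : ∑' t : ℕ, ((w + t : ℕ) : ℝ≥0∞)⁻¹ = ⊤ := by
  rcases Nat.eq_zero_or_pos w with rfl | hw
  -- Here the term at `t = 0` is `0⁻¹ = ⊤`.
  · exact ENNReal.tsum_eq_top_of_eq_top ⟨0, by simp⟩
  by_contra hne
  have e : ∀ t : ℕ, ((w + t : ℕ) : ℝ≥0∞)⁻¹ = (((w + t : ℕ) : NNReal)⁻¹ : NNReal) := fun t => by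
    rw [ENNReal.coe_inv (by positivity), ENNReal.coe_natCast]
  simp only [e] at hne
  have hs := NNReal.summable_coe.2 (ENNReal.tsum_coe_ne_top_iff_summable.1 hne)
  refine Real.not_summable_natCast_inv ((summable_nat_add_iff w).1 ?_)
  refine hs.congr fun t => ?_
  push_cast
  rw [add_comm]

/-- The mean absorption time of an island of colour `c` is infinite if the number of sites of
colour `c` is a submartingale. -/
theorem meanTime_dirac_eq_top {α β : I} {c : Bool} {γ : I}
    (h : ∀ a b : Bool, (γ : ℝ) * (if b = c then 1 else 0) + (1 - γ) * (if a = c then 1 else 0) ≤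
      trans α β c a b) {x : Config} (hx : Close x fun _ => !c) (hne : x ≠ fun _ => !c) :
    meanTime α β (Measure.dirac x) = ⊤ := by
  obtain ⟨k, hk⟩ := Function.ne_iff.1 hne
  have hk : x k = c := by simpa using hk
  obtain ⟨a, ha⟩ := hx.bddBelow
  obtain ⟨b, hb⟩ := hx.bddAbove
  have hsupp : ∀ k, x k = c → k ∈ Finset.Icc a b := fun k hk => by
    have hmem : k ∈ {i | x i ≠ !c} := by simp [hk]
    exact Finset.mem_Icc.2 ⟨ha hmem, hb hmem⟩
  set P := processLaw α β (Measure.dirac x)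
  have hind : Measurable (absorbingᶜ.indicator (1 : Config → ℝ≥0∞)) :=
    measurable_one.indicator measurableSet_absorbing.compl
  have hindt : ∀ t : ℕ, Measurable fun ω : ℕ → Config =>
      absorbingᶜ.indicator (1 : Config → ℝ≥0∞) (ω t) := fun t => hind.comp (measurable_pi_apply t)
  have hlow : ∀ t : ℕ, (((b + 1 - a).toNat + t : ℕ) : ℝ≥0∞)⁻¹ ≤
      ∫⁻ ω, absorbingᶜ.indicator (1 : Config → ℝ≥0∞) (ω t) ∂P := fun t => by
    have h1 : (1 : ℝ≥0∞) ≤ ∫⁻ ω, colourCount c (ω t) ∂P := by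
      refine ((one_le_colourCount hk).trans (colourCount_le_lintegral_iterate h x t)).trans ?_
      rw [← processLaw_map, lintegral_map (measurable_colourCount c) (measurable_pi_apply t)]
    have h2 : ∫⁻ ω, colourCount c (ω t) ∂P ≤ (((b + 1 - a).toNat + t : ℕ) : ℝ≥0∞) *
        ∫⁻ ω, absorbingᶜ.indicator (1 : Config → ℝ≥0∞) (ω t) ∂P := by
      rw [← lintegral_const_mul _ (hindt t)]
      refine lintegral_mono_ae ?_
      filter_upwards [ae_processLaw_admissible α β (Measure.dirac x),
        ae_processLaw_dirac_zero α β x] with ω hω h0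
      exact colourCount_le_mul_indicator t (mem_Icc_of_admissible hω (by simpa [h0] using hsupp) t)
    have h3 := h1.trans h2
    exact (ENNReal.inv_le_iff_le_mul (fun _ h0 => by simp only [h0, zero_mul] at h3; simp at h3)
      (fun h0 => (ENNReal.natCast_ne_top _ h0).elim)).2 h3
  -- The mean of `τ` is bounded below by the sum over `t` of the probabilities of being unabsorbed
  -- at time `t`.
  rw [eq_top_iff, ← tsum_inv_natCast_add (b + 1 - a).toNat]
  refine (ENNReal.tsum_le_tsum hlow).trans ?_
  rw [← lintegral_tsum fun t => (hindt t).aemeasurable]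
  refine lintegral_mono_ae ?_
  filter_upwards [ae_processLaw_admissible α β (Measure.dirac x)] with ω hω
  exact tsum_indicator_le_absorptionTime hω

/-! ### From single islands to archipelagos -/

/-- The mean absorption time is an average of the mean absorption times for deterministic initial
configurations. -/
theorem exists_measurable_meanTime (α β : I) : ∃ f : Config → ℝ≥0∞, Measurable f ∧
    ∀ μ : Measure Config, meanTime α β μ = ∫⁻ x, f x ∂μ := by
  let κ := Kernel.traj (X := fun _ => Config) (fun n => (stepKernel α β).comap
      (fun h : (Finset.Iic n → Config) => h ⟨n, Finset.mem_Iic.2 le_rfl⟩) (measurable_pi_apply _)) 0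
  let e := (MeasurableEquiv.piUnique fun _ : Finset.Iic 0 => Config).symm
  have hκ : Measurable fun z => ∫⁻ ω, absorptionTime ω ∂κ z :=
    measurable_absorptionTime.lintegral_kernel
  refine ⟨fun x => ∫⁻ ω, absorptionTime ω ∂κ (e x), hκ.comp e.measurable, fun μ => ?_⟩
  rw [meanTime, processLaw, Kernel.trajMeasure, Measure.lintegral_bind (Kernel.aemeasurable _)
    measurable_absorptionTime.aemeasurable, lintegral_map hκ e.measurable]

theorem meanTime_eq_top_of_ne_zero {α β : I} {μ : Measure Config} {S : Set Config}
    (hS : ∀ x ∈ S, meanTime α β (Measure.dirac x) = ⊤) (hμ : μ S ≠ 0) : meanTime α β μ = ⊤ := by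
  obtain ⟨f, hf, hfm⟩ := exists_measurable_meanTime α β
  rw [hfm]
  refine lintegral_eq_top_of_measure_eq_top_ne_zero hf.aemeasurable fun h0 =>
    hμ (measure_mono_null (fun x hx => ?_) h0)
  have := hS x hx
  rwa [hfm, lintegral_dirac' _ hf] at this

/-- Since `mix l` lives on the absorbing configurations, the chain is almost surely absorbed by the
deterministic time `t`. -/
theorem meanTime_le_of_iterate_eq_mix {α β : I} {μ : Measure Config} [IsProbabilityMeasure μ]
    {t : ℕ} {l : I} (h : (F α β)^[t] μ = mix l) : meanTime α β μ ≤ t := by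
  have hmix : mix l absorbingᶜ = 0 := by
    simp [mix, absorbing]
  have hae : ∀ᵐ x ∂(processLaw α β μ).map (fun ω => ω t), x ∈ absorbing := by
    rw [processLaw_map, h]
    exact hmix
  have hle : ∀ᵐ ω ∂processLaw α β μ, absorptionTime ω ≤ t := by
    filter_upwards [ae_of_ae_map (measurable_pi_apply t).aemeasurable hae] with ω hω
    exact iInf₂_le t hω
  exact (lintegral_mono_ae hle).trans (by simp)

end Archipelago

open Archipelago in
theorem mainTheorem5 (α β : unitInterval) (hα : 0 < α) (hβ : β < 1)
    (μ : MeasureTheory.Measure Archipelago.Config)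
    (hμ : μ ∈ Archipelago.archipelagos \
      (Archipelago.archipelagosMinus ∪ Archipelago.archipelagosPlus)) :
    Archipelago.meanTime α β μ = ⊤ ∧ Archipelago.measureTime α β μ = ⊤ := by
  obtain ⟨⟨hprob, hisl⟩, hnot⟩ := hμ
  -- If islands of pluses were null, `μ` would be an archipelago of minuses, which is excluded;
  -- likewise with the colours exchanged.
  have hplus : μ islandsPlus ≠ 0 := fun h0 => hnot <| Or.inl ⟨hprob, measure_mono_null
    (fun x hx => by
      by_cases hp : x ∈ islandsPlus
      · exact Or.inr hp
      · exact Or.inl fun h => h.elim hx hp) (measure_union_null hisl h0)⟩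
  have hminus : μ islandsMinus ≠ 0 := fun h0 => hnot <| Or.inr ⟨hprob, measure_mono_null
    (fun x hx => by
      by_cases hp : x ∈ islandsMinus
      · exact Or.inr hp
      · exact Or.inl fun h => h.elim hp hx) (measure_union_null hisl h0)⟩
  have hmean : meanTime α β μ = ⊤ := by
    rcases le_total 1 ((α : ℝ) + β) with hab | hab
    · refine meanTime_eq_top_of_ne_zero (fun x hx => ?_) hplus
      -- The comparison voter model copies the right neighbour with probability `α`; the only
      -- inequality with content is `1 - α ≤ β`.
      refine meanTime_dirac_eq_top (c := true) (γ := α) (fun a b => ?_) hx.1 hx.2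
      cases a <;> cases b <;> (simp [Archipelago.trans, plusProb]; try linarith)
    · refine meanTime_eq_top_of_ne_zero (fun x hx => ?_) hminus
      -- For minuses the right neighbour is copied with probability `1 - β`, which requires `β ≤ 1 -
      -- α`.
      refine meanTime_dirac_eq_top (c := false) (γ := unitInterval.symm β) (fun a b => ?_) hx.1 hx.2
      cases a <;> cases b <;> (simp [Archipelago.trans, plusProb]; try linarith)
  refine ⟨hmean, iInf₂_eq_top.2 fun t ⟨l, hl⟩ => ?_⟩
  have hle := meanTime_le_of_iterate_eq_mix hl
  rw [hmean, top_le_iff] at hle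
  exact (ENNReal.natCast_ne_top t hle).elim
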